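/- Let $g\ge 1$ be an integer and let $\ell\ge 3$ be a prime number. Let $\mathrm{Sp}(2g,\mathbb{F}_\ell)$ be the group of $2g\times 2g$ matrices over $\mathbb{F}_\ell$ that preserve the standard nondegenerate alternating form on $\mathbb{F}_\ell^{2g}$. An element $\tau\in\mathrm{Sp}(2g,\mathbb{F}_\ell)$ is called a transvection if $\tau\neq 1$ and there are a linear form $f$ on $\mathbb{F}_\ell^{2g}$ and a vector $v\in\mathbb{F}_\ell^{2g}$ with $f(v)=0$ such that $\tau(x)=x+f(x)v$ for all $x\in\mathbb{F}_\ell^{2g}$. If a subgroup $H$ of $\mathrm{Sp}(2g,\mathbb{F}_\ell)$ contains at least $\ell^{2g-1}$ transvections, then $H=\mathrm{Sp}(2g,\mathbb{F}_\ell)$. -/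

import Mathlib

/-- A square matrix over `K` is a (nontrivial) transvection if it is not the identity and acts on
column vectors as `x ↦ x + f x • v` for a linear form `f` and a vector `v` with `f v = 0`.
Mathlib's `LinearMap.transvection f v` is this map without the condition `f v = 0`, and it may be
the identity; both degenerate cases are excluded here. -/
def Matrix.IsNontrivialTransvection {n K : Type*} [Fintype n] [DecidableEq n] [Field K]
    (A : Matrix n n K) : Prop :=
  A ≠ 1 ∧ ∃ (f : Module.Dual K (n → K)) (v : n → K),
    f v = 0 ∧ Matrix.toLin' A = LinearMap.transvection f v

/-! Let S be the set of directions v all of whose transvections lie in H. Conjugating one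
transvection by another shows that S is hyperbolically closed, and counting
(`ncard_transvections_le`) gives |S| ≥ |V|/ℓ. Since transvections generate the symplectic group
(`eq_top_of_transvection_mem`), it suffices that S contains every nonzero vector, which is
`mem_of_card_le`.

That lemma is an induction on |V|. If a nonzero x is not in S, then off x^⊥ the set S meets each
coset of Fx at most once, so S ∩ x^⊥ has at least |x^⊥/Fx| elements. By induction its image in
x^⊥/Fx is everything nonzero. By pigeonhole two elements of S ∩ x^⊥ differ by a multiple of x, and
`mem_of_add_mem` then forces x ∈ S. -/

/-- A set of nonzero vectors which is stable under nonzero scalars and under sums of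
non-orthogonal vectors with respect to the bilinear form `B`. -/
structure IsHyperbolicallyClosed {F V : Type*} [Field F] [AddCommGroup V] [Module F V]
    (B : V →ₗ[F] V →ₗ[F] F) (S : Set V) : Prop where
  zero_notMem : (0 : V) ∉ S
  smul_mem : ∀ ⦃c : F⦄, c ≠ 0 → ∀ ⦃v⦄, v ∈ S → c • v ∈ S
  add_mem : ∀ ⦃v⦄, v ∈ S → ∀ ⦃w⦄, w ∈ S → B v w ≠ 0 → v + w ∈ S

/-! ### Hyperbolically closed sets. -/

namespace IsHyperbolicallyClosed

variable {F V : Type*} [Field F] [AddCommGroup V] [Module F V]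
  {B : V →ₗ[F] V →ₗ[F] F} {S : Set V}

theorem add_smul_mem (hS : IsHyperbolicallyClosed B S) {v w : V} (hv : v ∈ S) (hw : w ∈ S)
    (h : B v w ≠ 0) (a : F) : v + a • w ∈ S := by
  rcases eq_or_ne a 0 with rfl | ha
  · simpa using hv
  · exact hS.add_mem hv (hS.smul_mem ha hw) (by simp [ha, h])

theorem neg_mem (hS : IsHyperbolicallyClosed B S) {v : V} (hv : v ∈ S) : -v ∈ S := by
  simpa using hS.smul_mem (neg_ne_zero.mpr (one_ne_zero (α := F))) hv

/-- Two elements of `S` that differ by a multiple of `x` and are not orthogonal to `x` coincide,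
unless `x ∈ S`. -/
theorem mem_of_add_smul_mem (hS : IsHyperbolicallyClosed B S) (hB : B.IsAlt) {x s : V} {c : F}
    (hc : c ≠ 0) (hs : s ∈ S) (hsx : B x s ≠ 0) (h : s + c • x ∈ S) : x ∈ S := by
  have h1 : s + c • x + -s ∈ S := hS.add_mem h (hS.neg_mem hs) (by simp [hB s, hc, hsx])
  simpa [smul_smul, inv_mul_cancel₀ hc] using hS.smul_mem (inv_ne_zero hc) h1

/-- The aim is s + x ∈ S, since its difference with s is x. It is reached as (s - u) + (u + x),
where u = y + a • w is adjusted so that both sums are of non-orthogonal vectors; the second pairing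
is 2 B(s, x), whence the odd characteristic. -/
theorem mem_of_add_mem (hS : IsHyperbolicallyClosed B S) (hB : B.IsAlt) (h2 : (2 : F) ≠ 0)
    {x y z s : V} (hy : y ∈ S) (hyx : y + x ∈ S) (hz : z ∈ S) (hs : s ∈ S)
    (hxy : B x y = 0) (hxz : B x z = 0) (hyz : B y z ≠ 0) (hxs : B x s ≠ 0) : x ∈ S := by
  have hsx : B s x ≠ 0 := by rw [← hB.neg]; exact neg_ne_zero.mpr hxs
  have hyx0 : B y x = 0 := by rw [← hB.neg, hxy, neg_zero]
  have hzx0 : B z x = 0 := by rw [← hB.neg, hxz, neg_zero]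
  -- If z is orthogonal to s, then x + z = -y + (y + x + z) serves instead.
  obtain ⟨w, hw, hwx, hxw, hyw, hsw⟩ :
      ∃ w ∈ S, B w x = 0 ∧ B x w = 0 ∧ B y w ≠ 0 ∧ B s w ≠ 0 := by
    by_cases hsz : B s z = 0
    · refine ⟨x + z, ?_, by simp [hB x, hzx0], by simp [hB x, hxz], by simp [hyx0, hyz],
        by simp [hsz, hsx]⟩
      have h1 : y + x + z ∈ S := hS.add_mem hyx hz (by simp [hxz, hyz])
      have h3 := hS.add_mem (hS.neg_mem hy) h1 (by simp [hB y, hyx0, hyz])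
      rwa [add_assoc, neg_add_cancel_left] at h3
    · exact ⟨z, hz, hzx0, hxz, hyz, hsz⟩
  obtain ⟨a, ha⟩ : ∃ a : F, B s y + a * B s w = B s x :=
    ⟨(B s x - B s y) / B s w, by field_simp; ring⟩
  have hu : y + a • w ∈ S := hS.add_smul_mem hy hw hyw a
  have hux : y + x + a • w ∈ S := hS.add_smul_mem hyx hw (by simp [hxw, hyw]) a
  have h1 : s + -(y + a • w) ∈ S :=
    hS.add_mem hs (hS.neg_mem hu) (by rw [map_neg]; simpa [ha] using hsx)
  have h3 : s + -(y + a • w) + (y + x + a • w) ∈ S := by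
    refine hS.add_mem h1 hux ?_
    have e : y + x + a • w = (y + a • w) + x := by abel
    have : B (s + -(y + a • w)) (y + x + a • w) = 2 * B s x := by
      rw [e]
      simp only [map_add, map_neg, LinearMap.add_apply, LinearMap.neg_apply, map_smul,
        LinearMap.smul_apply, smul_eq_mul, hB y, hB w, hyx0, hwx]
      have := hB.neg y w
      rw [← this]
      linear_combination ha
    rw [this]
    exact mul_ne_zero h2 hsx
  refine hS.mem_of_add_smul_mem hB one_ne_zero hs hxs ?_
  convert h3 using 1
  rw [one_smul]
  abel

/-- For a nondegenerate alternating form over a finite field of odd characteristic, a hyperbolically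
closed set of density at least `1 / #F` contains every nonzero vector. -/
theorem mem_of_card_le {F : Type*} [Field F] [Finite F] (h2 : (2 : F) ≠ 0) {V : Type*}
    [AddCommGroup V] [Module F V] [Finite V] {B : V →ₗ[F] V →ₗ[F] F} (hB : B.IsAlt)
    (hnd : ∀ x ≠ 0, ∃ y, B x y ≠ 0) {S : Set V} (hS : IsHyperbolicallyClosed B S)
    (hcard : Nat.card V ≤ Nat.card F * S.ncard) {x : V} (hx : x ≠ 0) : x ∈ S := by
  induction hn : Nat.card V using Nat.strong_induction_on generalizing V with
  | _ n ih =>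
  by_contra hxS
  obtain ⟨t, hxt⟩ : ∃ t, B x t = 1 := by
    obtain ⟨y, hy⟩ := hnd x hx
    exact ⟨(B x y)⁻¹ • y, by simp [hy]⟩
  have htx : B t x = -1 := by rw [← hB.neg, hxt]
  -- U is the complement of the hyperbolic plane ⟨x, t⟩ and models x^⊥/Fx; `p` is the orthogonal
  -- projection onto it.
  let U : Submodule F V := LinearMap.ker (B x) ⊓ LinearMap.ker (B t)
  have hUx (u : U) : B x u = 0 := u.2.1
  have hUt (u : U) : B t u = 0 := u.2.2
  have hxU (u : U) : B u x = 0 := by rw [← hB.neg, hUx, neg_zero]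
  have htU (u : U) : B u t = 0 := by rw [← hB.neg, hUt, neg_zero]
  let p : V →ₗ[F] U := LinearMap.codRestrict U
    (LinearMap.id + (B t).smulRight x - (B x).smulRight t) (fun v => by
      constructor <;> simp [hB x, hB t, hxt, htx])
  have hpv (v : V) : (p v : V) = v + B t v • x - B x v • t := rfl
  have hp (v : V) : v = (p v : V) - B t v • x + B x v • t := by
    rw [hpv]; abel
  have hpu (u : U) : p u = u := by
    apply Subtype.ext; simp [hpv, hUx, hUt]
  let e : V ≃ F × F × U :=
    { toFun := fun v => (B t v, B x v, p v)
      invFun := fun w => (w.2.2 : V) - w.1 • x + w.2.1 • t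
      left_inv := fun v => (hp v).symm
      right_inv := fun w => by
        obtain ⟨a, b, u⟩ := w
        have hpx : p x = 0 := by apply Subtype.ext; simp [hpv, hB x, htx]
        have hpt : p t = 0 := by apply Subtype.ext; simp [hpv, hB t, hxt]
        simp [hpx, hpt, hpu, hUx, hUt, hB x, hB t, hxt, htx] }
  have hVU : Nat.card V = Nat.card F * (Nat.card F * Nat.card U) := by
    rw [Nat.card_congr e, Nat.card_prod, Nat.card_prod]
  have hF : 1 < Nat.card F := Finite.one_lt_card
  have hU : 0 < Nat.card U := Nat.card_pos
  let P : Set V := S ∩ {v | B x v = 0}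
  let Q : Set V := S \ {v | B x v = 0}
  have hPQ : P.ncard + Q.ncard = S.ncard := Set.ncard_inter_add_ncard_sdiff_eq_ncard S _
  have hpB {v w : V} (hv : B x v = 0) (hw : B x w = 0) : B (p v) (p w) = B v w := by
    conv_rhs => rw [hp v, hp w]
    simp [hv, hw, hB x, hUx, hxU]
  have hp0 {v : V} (hv : v ∈ P) : p v ≠ 0 := by
    intro h
    have h1 := hp v
    rw [h, hv.2, zero_smul, add_zero, Submodule.coe_zero, zero_sub, ← neg_smul] at h1
    have hc : -B t v ≠ 0 := by
      intro hc
      rw [hc, zero_smul] at h1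
      exact hS.zero_notMem (h1 ▸ hv.1)
    apply hxS
    have h3 := hS.smul_mem (inv_ne_zero hc) hv.1
    rwa [h1, smul_smul, ← h1, inv_mul_cancel₀ hc, one_smul] at h3
  -- Two elements of `Q` with equal `B x` and equal projection differ by a multiple of x, so they
  -- coincide.
  have hQ : Q.ncard ≤ (Nat.card F - 1) * Nat.card U := by
    have h1 : Q.ncard ≤ ((({0}ᶜ : Set F)) ×ˢ (Set.univ : Set U)).ncard := by
      refine Set.ncard_le_ncard_of_injOn (fun v => (B x v, p v)) (fun v hv => ⟨hv.2, trivial⟩) ?_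
        (Set.toFinite _)
      intro v hv w hw hvw
      obtain ⟨h1, h3⟩ := Prod.mk.inj hvw
      by_contra hne
      have hw' : w = v + (B t v - B t w) • x := by
        have h4 := congrArg Subtype.val h3
        rw [hpv, hpv, h1] at h4
        rw [sub_smul, ← add_sub_assoc, eq_sub_iff_add_eq]
        exact (sub_left_inj.mp h4).symm
      refine hxS (hS.mem_of_add_smul_mem hB (c := B t v - B t w) ?_ hv.1 hv.2 (hw' ▸ hw.1))
      intro h
      rw [h, zero_smul, add_zero] at hw'
      exact hne hw'.symm
    rwa [Set.ncard_prod, Set.ncard_compl, Set.ncard_singleton, Set.ncard_univ] at h1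
  have hP : Nat.card U ≤ P.ncard := by
    have h1 : Nat.card F * Nat.card U ≤ S.ncard :=
      Nat.le_of_mul_le_mul_left (hVU ▸ hcard) (by omega)
    have h3 : (Nat.card F - 1) * Nat.card U + Nat.card U = Nat.card F * Nat.card U := by
      rw [← Nat.succ_mul, Nat.succ_eq_add_one, Nat.sub_add_cancel hF.le]
    omega
  have hinj (T : Set U) (hT : ∀ v ∈ P, p v ∈ T) : P.ncard ≤ Nat.card F * T.ncard := by
    have h1 : P.ncard ≤ ((Set.univ : Set F) ×ˢ T).ncard := by
      refine Set.ncard_le_ncard_of_injOn (fun v => (B t v, p v)) (fun v hv => ⟨trivial, hT v hv⟩) ?_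
        (Set.toFinite _)
      intro v hv w hw hvw
      obtain ⟨h1, h3⟩ := Prod.mk.inj hvw
      exact e.injective (Prod.ext h1 (Prod.ext (hv.2.trans hw.2.symm) h3))
    rwa [Set.ncard_prod, Set.ncard_univ] at h1
  have hS' : IsHyperbolicallyClosed (B.domRestrict₁₂ U U) (p '' P) := by
    refine ⟨?_, ?_, ?_⟩
    · rintro ⟨v, hv, h⟩
      exact hp0 hv h
    · rintro c hc _ ⟨v, hv, rfl⟩
      refine ⟨c • v, ⟨hS.smul_mem hc hv.1, ?_⟩, map_smul _ _ _⟩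
      have h1 : B x v = 0 := hv.2
      simp [h1]
    · rintro _ ⟨v, hv, rfl⟩ _ ⟨w, hw, rfl⟩ h
      refine ⟨v + w, ⟨hS.add_mem hv.1 hw.1 ?_, ?_⟩, map_add _ _ _⟩
      · rw [← hpB hv.2 hw.2]; exact h
      · have h1 : B x v = 0 := hv.2
        have h3 : B x w = 0 := hw.2
        simp [h1, h3]
  have hndU : ∀ u : U, u ≠ 0 → ∃ w : U, B u w ≠ 0 := by
    intro u hu
    obtain ⟨y, hy⟩ := hnd u (by simpa using hu)
    refine ⟨p y, ?_⟩
    rw [hp y] at hy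
    simpa [hxU, htU] using hy
  have hlift (u : U) (hu : u ≠ 0) : u ∈ p '' P := by
    refine ih (Nat.card U) ?_ (B := B.domRestrict₁₂ U U) (fun v => hB v) hndU hS'
      (hP.trans (hinj _ fun v hv => Set.mem_image_of_mem _ hv)) hu rfl
    rw [← hn, hVU]
    nlinarith [Nat.mul_le_mul hF.le hU]
  have hcompl : ({0}ᶜ : Set U).ncard = Nat.card U - 1 := by
    rw [Set.ncard_compl, Set.ncard_singleton]
  -- Pigeonhole: |P| ≥ |U|, but U has only |U| - 1 nonzero vectors. If U = 0 this is already absurd,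
  -- so no base case is needed.
  obtain ⟨v, hv, w, hw, hvw, hne⟩ : ∃ v ∈ P, ∃ w ∈ P, p v = p w ∧ v ≠ w := by
    by_contra! h
    have := Set.ncard_le_ncard_of_injOn (s := P) (t := ({0}ᶜ : Set U)) p (fun v hv => hp0 hv)
      (fun v hv w hw hvw => h v hv w hw hvw) (Set.toFinite _)
    omega
  -- If S lay in x^⊥, it would have at most |F|(|U| - 1) elements, too few.
  obtain ⟨s, hs, hxs⟩ : ∃ s ∈ S, B x s ≠ 0 := by
    by_contra! h
    have hPS : P = S := Set.inter_eq_left.mpr h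
    have h1 := hinj ({0}ᶜ) fun v hv => hp0 hv
    have h3 : Nat.card F * Nat.card U ≤ S.ncard :=
      Nat.le_of_mul_le_mul_left (hVU ▸ hcard) (by omega)
    rw [hPS, hcompl] at h1
    have := Nat.le_of_mul_le_mul_left (h3.trans h1) (by omega)
    omega
  obtain ⟨u, hu⟩ := hndU (p v) (hp0 hv)
  obtain ⟨z, hz, rfl⟩ := hlift u (by rintro rfl; simp at hu)
  rw [hpB hv.2 hz.2] at hu
  have hvx : B x v = 0 := hv.2
  have hwx : B x w = 0 := hw.2
  have hw' : w = v + (B t v - B t w) • x := by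
    have h4 := congrArg Subtype.val hvw
    rw [hpv, hpv, hvx, hwx] at h4
    rw [sub_smul, ← add_sub_assoc, eq_sub_iff_add_eq]
    exact (sub_left_inj.mp h4).symm
  have hc : B t v - B t w ≠ 0 := by
    intro h
    rw [h, zero_smul, add_zero] at hw'
    exact hne hw'.symm
  generalize B t v - B t w = c at hw' hc
  refine hxS (hS.mem_of_add_mem hB h2 (y := c⁻¹ • v) (z := z) (s := s)
    (hS.smul_mem (inv_ne_zero hc) hv.1) ?_ hz.1 hs (by simp [hvx]) hz.2 (by simp [hc, hu]) hxs)
  have := hS.smul_mem (inv_ne_zero hc) hw.1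
  rwa [hw', smul_add, smul_smul, inv_mul_cancel₀ hc, one_smul] at this

end IsHyperbolicallyClosed

/-! ### The standard form and symplectic transvections. -/

namespace SymplecticGroup

open Matrix

variable {l F : Type*} [DecidableEq l] [Fintype l] [Field F]

variable (l F) in
/-- The standard alternating form on `F ^ (l ⊕ l)`, with Gram matrix `J`. -/
noncomputable def form : (l ⊕ l → F) →ₗ[F] (l ⊕ l → F) →ₗ[F] F :=
  Matrix.toLinearMap₂' F (J l F)

theorem form_apply (v w : l ⊕ l → F) : form l F v w = v ⬝ᵥ J l F *ᵥ w :=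
  Matrix.toLinearMap₂'_apply' _ _ _

theorem form_isAlt : (form l F).IsAlt := by
  intro v
  rw [form_apply, J, fromBlocks_mulVec]
  simp [dotProduct, Fintype.sum_sum_type, neg_mulVec, mul_comm]

theorem exists_form_ne_zero {v : l ⊕ l → F} (hv : v ≠ 0) : ∃ w, form l F v w ≠ 0 := by
  by_contra! h
  apply hv
  refine dotProduct_eq_zero v fun w => ?_
  have h1 := h (-(J l F *ᵥ w))
  rwa [form_apply, mulVec_neg, mulVec_mulVec, J_squared, neg_mulVec, neg_neg, one_mulVec] at h1

theorem mem_iff_form {A : Matrix (l ⊕ l) (l ⊕ l) F} :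
    A ∈ symplecticGroup l F ↔ ∀ v w, form l F (A *ᵥ v) (A *ᵥ w) = form l F v w := by
  have key (v w : l ⊕ l → F) :
      form l F (A *ᵥ v) (A *ᵥ w) = v ⬝ᵥ (Aᵀ * J l F * A) *ᵥ w := by
    rw [form_apply, mulVec_mulVec, Matrix.mul_assoc, ← mulVec_mulVec (M := Aᵀ),
      dotProduct_mulVec v, vecMul_transpose]
  rw [mem_iff']
  refine ⟨fun h v w => by rw [key, h, form_apply], fun h => ?_⟩
  refine Matrix.ext_of_mulVec_single fun i => ?_
  refine dotProduct_eq _ _ fun v => ?_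
  rw [dotProduct_comm, ← key, h, form_apply, dotProduct_comm]

theorem form_mulVec (A : symplecticGroup l F) (v w : l ⊕ l → F) :
    form l F (A.1 *ᵥ v) (A.1 *ᵥ w) = form l F v w :=
  mem_iff_form.mp A.2 v w

theorem ext_mulVec {A B : symplecticGroup l F} (h : ∀ v, A.1 *ᵥ v = B.1 *ᵥ v) : A = B :=
  Subtype.ext (Matrix.ext_of_mulVec_single fun _ => h _)

theorem transvection_matrix_mulVec (v : l ⊕ l → F) (a : F) (x : l ⊕ l → F) :
    (1 + a • vecMulVec v (v ᵥ* J l F)) *ᵥ x = x + (a * form l F v x) • v := by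
  rw [add_mulVec, one_mulVec, smul_mulVec, vecMulVec_mulVec, ← dotProduct_mulVec, ← form_apply,
    op_smul_eq_smul, smul_smul]

/-- The symplectic transvection `x ↦ x + a B(v, x) v`. -/
def transvection (v : l ⊕ l → F) (a : F) : symplecticGroup l F :=
  ⟨1 + a • vecMulVec v (v ᵥ* J l F), mem_iff_form.mpr fun x y => by
    rw [transvection_matrix_mulVec, transvection_matrix_mulVec]
    simp only [map_add, map_smul, LinearMap.add_apply, LinearMap.smul_apply, smul_eq_mul,
      form_isAlt v]
    rw [← form_isAlt.neg x v]
    ring⟩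

theorem transvection_mulVec (v : l ⊕ l → F) (a : F) (x : l ⊕ l → F) :
    (transvection v a).1 *ᵥ x = x + (a * form l F v x) • v :=
  transvection_matrix_mulVec v a x

theorem transvection_mul (v : l ⊕ l → F) (a b : F) :
    transvection v a * transvection v b = transvection v (a + b) := by
  refine ext_mulVec fun x => ?_
  rw [Submonoid.coe_mul, ← mulVec_mulVec]
  simp only [transvection_mulVec, map_add, map_smul, form_isAlt v, smul_zero, add_zero]
  rw [add_mul, add_smul]
  abel

theorem transvection_zero (v : l ⊕ l → F) : transvection v 0 = 1 :=
  ext_mulVec fun x => by simp [transvection_mulVec]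

theorem transvection_pow (v : l ⊕ l → F) (a : F) (k : ℕ) :
    transvection v a ^ k = transvection v (k * a) := by
  induction k with
  | zero => simp [transvection_zero]
  | succ k ih => rw [pow_succ, ih, transvection_mul]; congr 1; push_cast; ring

theorem transvection_smul (c : F) (v : l ⊕ l → F) (a : F) :
    transvection (c • v) a = transvection v (c ^ 2 * a) :=
  ext_mulVec fun x => by
    simp only [transvection_mulVec, map_smul, LinearMap.smul_apply, smul_eq_mul, smul_smul]
    congr 2
    ring

theorem conj_transvection (A : symplecticGroup l F) (v : l ⊕ l → F) (a : F) :
    A * transvection v a * A⁻¹ = transvection (A.1 *ᵥ v) a := by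
  rw [mul_inv_eq_iff_eq_mul]
  refine ext_mulVec fun x => ?_
  simp only [Submonoid.coe_mul, ← mulVec_mulVec, transvection_mulVec, form_mulVec, mulVec_add,
    mulVec_smul]

/-- The transvection in the direction `w - v` that maps `w` to `v`. -/
theorem transvection_sub_mulVec {v w : l ⊕ l → F} (h : form l F v w ≠ 0) :
    (transvection (w - v) (form l F v w)⁻¹).1 *ᵥ w = v := by
  rw [transvection_mulVec]
  simp [form_isAlt w, h]

theorem form_sub_eq_zero {A : symplecticGroup l F} {x : l ⊕ l → F} (hx : A.1 *ᵥ x = x)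
    (v : l ⊕ l → F) : form l F (A.1 *ᵥ v - v) x = 0 := by
  have := form_mulVec A v x
  rw [hx] at this
  simp [this]

/-! ### Generation by transvections. -/

/-- Some product of transvections fixes every vector fixed by `A`, and maps `A v` to `v`. -/
theorem exists_fixing_of_transvection_mem {H : Subgroup (symplecticGroup l F)}
    (hH : ∀ v a, transvection v a ∈ H) (A : symplecticGroup l F) (v : l ⊕ l → F)
    (hv : A.1 *ᵥ v ≠ v) :
    ∃ T ∈ H, (∃ v, A.1 *ᵥ v ≠ v ∧ T.1 *ᵥ (A.1 *ᵥ v) = v) ∧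
      ∀ x, A.1 *ᵥ x = x → T.1 *ᵥ x = x := by
  by_cases h : ∀ w, form l F w (A.1 *ᵥ w) = 0
  · obtain ⟨u, hu⟩ := exists_form_ne_zero (sub_ne_zero.mpr hv)
    have hpol : form l F v (A.1 *ᵥ u) + form l F u (A.1 *ᵥ v) = 0 := by
      have := h (v + u)
      simpa [mulVec_add, h] using this
    have e1 := form_isAlt.neg u (A.1 *ᵥ v)
    have e2 := form_isAlt.neg u v
    let z := v + (A.1 *ᵥ u - u)
    have hvz : form l F v z ≠ 0 := by
      have : form l F v z = form l F (A.1 *ᵥ v - v) u := by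
        simp only [z, map_add, map_sub, LinearMap.sub_apply, form_isAlt v]
        linear_combination hpol + e1
      rwa [this]
    have hzv : form l F z (A.1 *ᵥ v) ≠ 0 := by
      have : form l F z (A.1 *ᵥ v) = form l F (A.1 *ᵥ v - v) u := by
        simp only [z, map_add, map_sub, LinearMap.add_apply, LinearMap.sub_apply, h, form_mulVec]
        linear_combination e1 - e2
      rwa [this]
    refine ⟨_, mul_mem (hH (z - v) (form l F v z)⁻¹)
      (hH (A.1 *ᵥ v - z) (form l F z (A.1 *ᵥ v))⁻¹), ⟨v, hv, ?_⟩, fun x hx => ?_⟩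
    · rw [Submonoid.coe_mul, ← mulVec_mulVec, transvection_sub_mulVec hzv,
        transvection_sub_mulVec hvz]
    · have h1 : form l F (z - v) x = 0 := by
        simpa [z] using form_sub_eq_zero hx u
      have h2 : form l F (A.1 *ᵥ v - z) x = 0 := by
        have e : A.1 *ᵥ v - z = (A.1 *ᵥ v - v) - (A.1 *ᵥ u - u) := by simp only [z]; abel
        rw [e, map_sub, LinearMap.sub_apply, form_sub_eq_zero hx, form_sub_eq_zero hx, sub_zero]
      rw [Submonoid.coe_mul, ← mulVec_mulVec, transvection_mulVec _ _ x, h2]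
      rw [mul_zero, zero_smul, add_zero, transvection_mulVec, h1, mul_zero, zero_smul, add_zero]
  · push Not at h
    obtain ⟨w, hw⟩ := h
    refine ⟨_, hH (A.1 *ᵥ w - w) (form l F w (A.1 *ᵥ w))⁻¹,
      ⟨w, fun h => hw (by rw [h, form_isAlt w]), transvection_sub_mulVec hw⟩, fun x hx => ?_⟩
    rw [transvection_mulVec, form_sub_eq_zero hx]
    simp

/-- The symplectic group over a finite field is generated by transvections. -/
theorem eq_top_of_transvection_mem [Finite F] {H : Subgroup (symplecticGroup l F)}
    (hH : ∀ v a, transvection v a ∈ H) : H = ⊤ := by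
  rw [eq_top_iff]
  rintro A -
  -- Multiplying by T keeps all fixed vectors except that A w = w need not hold for the new one, so
  -- fewer vectors are moved.
  induction hn : {x | A.1 *ᵥ x ≠ x}.ncard using Nat.strong_induction_on generalizing A with
  | _ n ih =>
  by_cases hA : ∀ v, A.1 *ᵥ v = v
  · have : A = 1 := ext_mulVec fun v => by simpa using hA v
    exact this ▸ one_mem H
  · push Not at hA
    obtain ⟨v, hv⟩ := hA
    obtain ⟨T, hT, ⟨w, hw, hTw⟩, hfix⟩ := exists_fixing_of_transvection_mem hH A v hv
    refine (Subgroup.mul_mem_cancel_left H hT).mp (ih _ ?_ rfl)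
    rw [← hn]
    refine Set.ncard_lt_ncard ?_ (Set.toFinite _)
    refine Set.ssubset_iff_of_subset ?_ |>.mpr ⟨w, hw, ?_⟩
    · intro x hx hx'
      apply hx
      rw [Submonoid.coe_mul, ← mulVec_mulVec, hx', hfix x hx']
    · simp [← mulVec_mulVec, hTw]

/-- Every transvection in the symplectic group is a symplectic transvection. -/
theorem exists_eq_transvection {τ : symplecticGroup l F} (hτ : τ.1.IsNontrivialTransvection) :
    ∃ (v : l ⊕ l → F) (a : F), v ≠ 0 ∧ a ≠ 0 ∧ τ = transvection v a := by
  obtain ⟨h1, f, v, -, h⟩ := hτ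
  have happ (x : l ⊕ l → F) : τ.1 *ᵥ x = x + f x • v := by
    rw [← toLin'_apply, h, LinearMap.transvection.apply]
  have hne : ∃ y, f y • v ≠ 0 := by
    by_contra! h0
    exact h1 (congrArg Subtype.val (ext_mulVec (A := τ) (B := 1) fun x => by simp [happ, h0]))
  obtain ⟨y, hy⟩ := hne
  have hv : v ≠ 0 := right_ne_zero_of_smul hy
  have hfy : f y ≠ 0 := left_ne_zero_of_smul hy
  -- Invariance of the form makes f proportional to B(v, ·).
  have hrel (x z : l ⊕ l → F) : f z * form l F v x = f x * form l F v z := by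
    have := form_mulVec τ x z
    rw [happ, happ] at this
    simp only [map_add, map_smul, LinearMap.add_apply, LinearMap.smul_apply, smul_eq_mul,
      form_isAlt v] at this
    rw [← form_isAlt.neg v x] at this
    linear_combination -this
  obtain ⟨w, hw⟩ := exists_form_ne_zero hv
  have hfw : f w ≠ 0 := by
    intro h0
    have := hrel w y
    rw [h0, zero_mul] at this
    exact mul_ne_zero hfy hw this
  refine ⟨v, f w / form l F v w, hv, div_ne_zero hfw hw, ext_mulVec fun x => ?_⟩
  rw [happ, transvection_mulVec]
  congr 2
  field_simp
  linear_combination - hrel x w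

/-! ### Transvection directions of a subgroup and their number. -/

/-- The nonzero vectors `v` such that all transvections in the direction `v` lie in `H`. -/
def transvectionDirections (H : Subgroup (symplecticGroup l F)) : Set (l ⊕ l → F) :=
  {v | v ≠ 0 ∧ ∀ a, transvection v a ∈ H}

end SymplecticGroup

namespace SymplecticGroup

open Matrix

variable {l F : Type*} [DecidableEq l] [Fintype l] [Field F]

theorem isHyperbolicallyClosed_transvectionDirections (H : Subgroup (symplecticGroup l F)) :
    IsHyperbolicallyClosed (form l F) (transvectionDirections H) where
  zero_notMem h := h.1 rfl
  smul_mem c hc v hv := ⟨smul_ne_zero hc hv.1, fun a => by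
    rw [transvection_smul]; exact hv.2 _⟩
  add_mem v hv w hw h := by
    have e : v + w = (transvection v (form l F v w)⁻¹).1 *ᵥ w := by
      rw [transvection_mulVec, inv_mul_cancel₀ h, one_smul, add_comm]
    refine ⟨fun h0 => h ?_, fun a => ?_⟩
    · rw [eq_neg_of_add_eq_zero_right h0, map_neg, form_isAlt v, neg_zero]
    · rw [e, ← conj_transvection]
      exact mul_mem (mul_mem (hv.2 _) (hw.2 a)) (inv_mem (hv.2 _))

/-- Over a prime field, a nontrivial transvection generates all those in its direction. -/
theorem transvection_mem_of_mem {p : ℕ} [Fact p.Prime] {H : Subgroup (symplecticGroup l (ZMod p))}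
    {v : l ⊕ l → ZMod p} {a : ZMod p} (ha : a ≠ 0) (h : transvection v a ∈ H) (b : ZMod p) :
    transvection v b ∈ H := by
  have := pow_mem h (b * a⁻¹).val
  rwa [transvection_pow, ZMod.natCast_zmod_val, inv_mul_cancel_right₀ ha] at this

/-- Over a prime field, a subgroup contains at most as many transvections as it has transvection
directions: there are `p - 1` of each on every line. -/
theorem ncard_transvections_le {p : ℕ} [Fact p.Prime] (H : Subgroup (symplecticGroup l (ZMod p))) :
    {τ : symplecticGroup l (ZMod p) | τ ∈ H ∧ τ.1.IsNontrivialTransvection}.ncard ≤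
      (transvectionDirections H).ncard := by
  have hex (τ : symplecticGroup l (ZMod p)) : ∃ (v : l ⊕ l → ZMod p) (a : ZMod p),
      τ.1.IsNontrivialTransvection → v ≠ 0 ∧ a ≠ 0 ∧ τ = transvection v a := by
    by_cases hτ : τ.1.IsNontrivialTransvection
    · obtain ⟨v, a, h⟩ := exists_eq_transvection hτ
      exact ⟨v, a, fun _ => h⟩
    · exact ⟨0, 0, fun h => absurd h hτ⟩
  choose v a hva using hex
  have key : ({τ : symplecticGroup l (ZMod p) | τ ∈ H ∧ τ.1.IsNontrivialTransvection} ×ˢ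
      ({0}ᶜ : Set (ZMod p))).ncard ≤
      (transvectionDirections H ×ˢ ({0}ᶜ : Set (ZMod p))).ncard := by
    -- The direction v of τ is only defined up to scaling; (c v, c⁻² a) are the other parameters of
    -- the same τ, so they determine τ and then c.
    refine Set.ncard_le_ncard_of_injOn (fun x => (x.2 • v x.1, (x.2 ^ 2)⁻¹ * a x.1)) ?_ ?_
      (Set.toFinite _)
    · rintro ⟨τ, c⟩ ⟨⟨hτH, hτ⟩, hc⟩
      obtain ⟨hv, ha, h⟩ := hva τ hτ
      replace hc : c ≠ 0 := hc
      refine ⟨⟨smul_ne_zero hc hv, fun b => ?_⟩, mul_ne_zero (inv_ne_zero (pow_ne_zero 2 hc)) ha⟩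
      rw [transvection_smul]
      exact transvection_mem_of_mem ha (h ▸ hτH) _
    · rintro ⟨τ, c⟩ ⟨⟨-, hτ⟩, hc⟩ ⟨σ, d⟩ ⟨⟨-, hσ⟩, hd⟩ heq
      obtain ⟨hv, -, h⟩ := hva τ hτ
      obtain ⟨-, -, h'⟩ := hva σ hσ
      replace hc : c ≠ 0 := hc
      replace hd : d ≠ 0 := hd
      obtain ⟨h1, h2⟩ := Prod.mk.inj heq
      dsimp only at h1 h2
      have h3 : τ = σ := by
        have e := congrArg₂ transvection h1 h2
        rwa [transvection_smul, transvection_smul, mul_inv_cancel_left₀ (pow_ne_zero 2 hc),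
          mul_inv_cancel_left₀ (pow_ne_zero 2 hd), ← h, ← h'] at e
      subst h3
      rw [smul_left_injective _ hv h1]
  rw [Set.ncard_prod, Set.ncard_prod] at key
  exact Nat.le_of_mul_le_mul_right key
    ((Set.ncard_pos (Set.toFinite _)).mpr ⟨1, one_ne_zero⟩)

end SymplecticGroup

theorem lemma2p2 (g : ℕ) (hg : 1 ≤ g) (ℓ : ℕ) [Fact ℓ.Prime] (hℓ : 3 ≤ ℓ)
    (H : Subgroup (Matrix.symplecticGroup (Fin g) (ZMod ℓ)))
    (hH : ℓ ^ (2 * g - 1) ≤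
      Set.ncard {τ : Matrix.symplecticGroup (Fin g) (ZMod ℓ) |
        τ ∈ H ∧ (τ : Matrix (Fin g ⊕ Fin g) (Fin g ⊕ Fin g) (ZMod ℓ)).IsNontrivialTransvection}) :
    H = ⊤ := by
  have h2 : (2 : ZMod ℓ) ≠ 0 := by
    intro h
    have : ((2 : ℕ) : ZMod ℓ) = 0 := by exact_mod_cast h
    have := Nat.le_of_dvd two_pos ((ZMod.natCast_eq_zero_iff 2 ℓ).mp this)
    omega
  have hcard : Nat.card (Fin g ⊕ Fin g → ZMod ℓ) ≤
      Nat.card (ZMod ℓ) * (SymplecticGroup.transvectionDirections H).ncard := by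
    have e : Nat.card (Fin g ⊕ Fin g → ZMod ℓ) = ℓ * ℓ ^ (2 * g - 1) := by
      rw [Nat.card_fun, Nat.card_zmod, Nat.card_eq_fintype_card, Fintype.card_sum,
        Fintype.card_fin, ← pow_succ']
      congr 1
      omega
    rw [e, Nat.card_zmod]
    exact Nat.mul_le_mul_left _ (hH.trans (SymplecticGroup.ncard_transvections_le H))
  refine SymplecticGroup.eq_top_of_transvection_mem fun v a => ?_
  rcases eq_or_ne v 0 with rfl | hv
  · have : SymplecticGroup.transvection (0 : Fin g ⊕ Fin g → ZMod ℓ) a = 1 :=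
      SymplecticGroup.ext_mulVec fun x => by simp [SymplecticGroup.transvection_mulVec]
    exact this ▸ one_mem H
  · exact ((SymplecticGroup.isHyperbolicallyClosed_transvectionDirections H).mem_of_card_le h2
      SymplecticGroup.form_isAlt (fun _ => SymplecticGroup.exists_form_ne_zero) hcard hv).2 a
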